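/- Let $G$ be a Hausdorff topological group with unit $e$ and let $K$ be a closed subgroup of $G$. A function $\varphi:G\to\mathbb{C}$ is of positive type if $\sum_{i=1}^n\sum_{j=1}^n c_i\overline{c_j}\,\varphi(g_j^{-1}g_i)\ge 0$ for all $n$, all $g_1,\dots,g_n\in G$ and all $c_1,\dots,c_n\in\mathbb{C}$. Let $\mathcal{P}^\natural(G)$ be the convex cone of continuous functions $\varphi:G\to\mathbb{C}$ of positive type that are $K$-biinvariant, i.e. $\varphi(k_1gk_2)=\varphi(g)$ for all $k_1,k_2\in K$ and $g\in G$. Order it by $\varphi\ll\psi$ if and only if $\psi-\varphi\in\mathcal{P}^\natural(G)$; the cone is called a lattice if any two of its elements have a least upper bound and a greatest lower bound in $\mathcal{P}^\natural(G)$ for this order. For $\varphi\in\mathcal{P}^\natural(G)$, let $(\pi^\varphi,\mathcal{H}^\varphi,\xi^\varphi)$ be the triplet given by the Gelfand-Naimark-Segal construction: $\pi^\varphi$ is a unitary representation of $G$ on the Hilbert space $\mathcal{H}^\varphi$, with a cyclic vector $\xi^\varphi$ such that $\varphi(g)=\langle\pi^\varphi(g)\xi^\varphi,\xi^\varphi\rangle$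 for all $g\in G$ (it is unique up to unitary equivalence). Let $\pi^\varphi(G)'$ be the commutant of $\pi^\varphi(G)$, i.e. the algebra of all bounded operators on $\mathcal{H}^\varphi$ that commute with $\pi^\varphi(g)$ for every $g\in G$. Then the cone $\mathcal{P}^\natural(G)$ is a lattice if and only if, for every $\varphi\in\mathcal{P}^\natural(G)$, the algebra $\pi^\varphi(G)'$ is commutative. -/

import Mathlib

open scoped ComplexOrder InnerProductSpace ComplexConjugate

noncomputable section

namespace PositiveType

/-! ### Cones and their proper order -/

/-- The proper order of a cone `Γ`: `x ≪ y` if and only if `y - x ∈ Γ`. -/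
def ConeLE {E : Type*} [AddCommGroup E] [Module ℝ E] (Γ : ConvexCone ℝ E) (x y : E) : Prop :=
  y - x ∈ Γ

/-- `s` is a least upper bound of `x` and `y` in the cone `Γ`, for the proper order of `Γ`. -/
def IsConeSup {E : Type*} [AddCommGroup E] [Module ℝ E] (Γ : ConvexCone ℝ E) (x y s : E) : Prop :=
  s ∈ Γ ∧ ConeLE Γ x s ∧ ConeLE Γ y s ∧ ∀ t ∈ Γ, ConeLE Γ x t → ConeLE Γ y t → ConeLE Γ s t

/-- `i` is a greatest lower bound of `x` and `y` in the cone `Γ`, for the proper order of `Γ`. -/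
def IsConeInf {E : Type*} [AddCommGroup E] [Module ℝ E] (Γ : ConvexCone ℝ E) (x y i : E) : Prop :=
  i ∈ Γ ∧ ConeLE Γ i x ∧ ConeLE Γ i y ∧ ∀ t ∈ Γ, ConeLE Γ t x → ConeLE Γ t y → ConeLE Γ t i

/-- The cone `Γ` is a lattice: any two of its elements have a least upper bound and a greatest
lower bound in `Γ`, for the proper order of `Γ`. -/
def IsLatticeCone {E : Type*} [AddCommGroup E] [Module ℝ E] (Γ : ConvexCone ℝ E) : Prop :=
  ∀ x ∈ Γ, ∀ y ∈ Γ, (∃ s, IsConeSup Γ x y s) ∧ (∃ i, IsConeInf Γ x y i)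

/-! ### Functions of positive type -/

/-- `φ : G → ℂ` is of positive type: `∑ᵢ ∑ⱼ cᵢ c̄ⱼ φ(gⱼ⁻¹ gᵢ)` is a nonnegative real number for all
finite families `gᵢ ∈ G`, `cᵢ ∈ ℂ`. (In `ℂ`, `0 ≤ z` means that `z` is real and nonnegative.) -/
def IsPositiveType {G : Type*} [Group G] (φ : G → ℂ) : Prop :=
  ∀ (n : ℕ) (g : Fin n → G) (c : Fin n → ℂ),
    0 ≤ ∑ i, ∑ j, c i * conj (c j) * φ ((g j)⁻¹ * g i)

/-- `φ` is `K`-biinvariant. -/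
def IsBiinvariant {G : Type*} [Group G] (K : Subgroup G) (φ : G → ℂ) : Prop :=
  ∀ k₁ ∈ K, ∀ k₂ ∈ K, ∀ g : G, φ (k₁ * g * k₂) = φ g

/-- The convex cone of continuous `K`-biinvariant functions of positive type on `G`. -/
def biinvariantCone {G : Type*} [Group G] [TopologicalSpace G] (K : Subgroup G) :
    ConvexCone ℝ (G → ℂ) where
  carrier := {φ | IsPositiveType φ ∧ Continuous φ ∧ IsBiinvariant K φ}
  smul_mem' := by
    rintro r hr φ ⟨h1, h2, h3⟩
    refine ⟨fun n g c => ?_, h2.const_smul r, fun k₁ hk₁ k₂ hk₂ g => ?_⟩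
    · have h := mul_nonneg (Complex.zero_le_real.2 hr.le) (h1 n g c)
      rw [Finset.mul_sum] at h
      refine h.trans_eq (Finset.sum_congr rfl fun i _ => ?_)
      rw [Finset.mul_sum]
      refine Finset.sum_congr rfl fun j _ => ?_
      simp only [Pi.smul_apply, Complex.real_smul]
      ring
    · simp only [Pi.smul_apply, h3 k₁ hk₁ k₂ hk₂ g]
  add_mem' := by
    rintro φ ⟨h1, h2, h3⟩ ψ ⟨h1', h2', h3'⟩
    refine ⟨fun n g c => ?_, h2.add h2', fun k₁ hk₁ k₂ hk₂ g => ?_⟩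
    · refine (add_nonneg (h1 n g c) (h1' n g c)).trans_eq ?_
      simp only [Pi.add_apply, mul_add, Finset.sum_add_distrib]
    · simp only [Pi.add_apply, h3 k₁ hk₁ k₂ hk₂ g, h3' k₁ hk₁ k₂ hk₂ g]

/-- A function of positive type is hermitian. -/
theorem IsPositiveType.hermitian {G : Type*} [Group G] {φ : G → ℂ} (hφ : IsPositiveType φ)
    (g : G) : conj (φ g) = φ g⁻¹ := by
  have h0 := hφ 1 ![1] ![1]
  have h1 := hφ 2 ![g, 1] ![1, 1]
  have h2 := hφ 2 ![g, 1] ![1, Complex.I]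
  simp [Fin.sum_univ_two] at h0 h1 h2
  rw [Complex.le_def] at h0 h1 h2
  have a := h0.2
  have b := h1.2
  have c := h2.2
  simp at a b c
  apply Complex.ext <;> simp <;> linarith

/-! ### The GNS construction -/

section GNS

variable {G : Type*} [Group G]

/-- For finitely supported measures `μ = ∑ aᵢ δ_{xᵢ}` and `ν = ∑ bⱼ δ_{yⱼ}` on `G`, this is
`∑ᵢⱼ āᵢ bⱼ φ(xᵢ⁻¹ yⱼ)`. As everywhere in Mathlib, it is linear in the second variable. -/
def preInner (φ : G → ℂ) (μ ν : G →₀ ℂ) : ℂ :=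
  μ.sum fun x a => ν.sum fun y b => conj a * b * φ (x⁻¹ * y)

theorem preInner_conj {φ : G → ℂ} (hφ : IsPositiveType φ) (μ ν : G →₀ ℂ) :
    conj (preInner φ ν μ) = preInner φ μ ν := by
  simp only [preInner, Finsupp.sum, map_sum]
  rw [Finset.sum_comm]
  refine Finset.sum_congr rfl fun x _ => Finset.sum_congr rfl fun y _ => ?_
  simp only [map_mul, hφ.hermitian, mul_inv_rev, inv_inv, Complex.conj_conj]
  ring

theorem preInner_self_nonneg {φ : G → ℂ} (hφ : IsPositiveType φ) (μ : G →₀ ℂ) :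
    0 ≤ preInner φ μ μ := by
  let e := μ.support.equivFin.symm
  refine (hφ _ (fun i => (e i : G)) (fun i => μ (e i))).trans_eq ?_
  simp only [preInner, Finsupp.sum]
  rw [e.sum_comp (fun x : μ.support => ∑ j, μ x * conj (μ (e j)) * φ ((e j : G)⁻¹ * x)),
    Finset.sum_comm,
    e.sum_comp (fun y : μ.support => ∑ x : μ.support, μ x * conj (μ y) * φ ((y : G)⁻¹ * x)),
    ← Finset.sum_coe_sort μ.support]
  refine Finset.sum_congr rfl fun y _ => ?_
  rw [← Finset.sum_coe_sort μ.support]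
  refine Finset.sum_congr rfl fun x _ => ?_
  ring

theorem preInner_add_left (φ : G → ℂ) (μ ν ρ : G →₀ ℂ) :
    preInner φ (μ + ν) ρ = preInner φ μ ρ + preInner φ ν ρ := by
  refine Finsupp.sum_add_index' (fun x => ?_) (fun x a b => ?_)
  · simp
  · simp [add_mul, Finsupp.sum, Finset.sum_add_distrib]

theorem preInner_smul_left (φ : G → ℂ) (μ ν : G →₀ ℂ) (r : ℂ) :
    preInner φ (r • μ) ν = conj r * preInner φ μ ν := by
  refine (Finsupp.sum_smul_index' (fun x => ?_)).trans ?_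
  · simp
  · simp only [preInner, Finsupp.sum, Finset.mul_sum, smul_eq_mul, map_mul, mul_assoc]

/-- Left translation of finitely supported measures: `δ_x ↦ δ_{gx}`. -/
def translate (g : G) : (G →₀ ℂ) →ₗ[ℂ] (G →₀ ℂ) :=
  Finsupp.lmapDomain ℂ ℂ (fun x : G => g * x)

theorem translate_mul (g h : G) (μ : G →₀ ℂ) :
    translate (g * h) μ = translate g (translate h μ) := by
  simp only [translate, Finsupp.lmapDomain_apply, ← Finsupp.mapDomain_comp]
  congr 1
  ext x
  simp [mul_assoc]

theorem translate_one (μ : G →₀ ℂ) : translate 1 μ = μ := by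
  simp only [translate, Finsupp.lmapDomain_apply, one_mul]
  exact Finsupp.mapDomain_id

theorem preInner_translate (φ : G → ℂ) (g : G) (μ ν : G →₀ ℂ) :
    preInner φ (translate g μ) (translate g ν) = preInner φ μ ν := by
  simp only [preInner, translate, Finsupp.lmapDomain_apply,
    Finsupp.sum_mapDomain_index_inj (mul_right_injective g), mul_inv_rev, mul_assoc,
    inv_mul_cancel_left]

variable {φ : G → ℂ}

/-- The space of finitely supported measures on `G`, endowed with the semi-inner product
`preInner φ` defined by the function `φ` of positive type. -/
@[nolint unusedArguments]
def PreGNS (_hφ : IsPositiveType φ) : Type _ := G →₀ ℂ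

instance (hφ : IsPositiveType φ) : AddCommGroup (PreGNS hφ) :=
  inferInstanceAs (AddCommGroup (G →₀ ℂ))
instance (hφ : IsPositiveType φ) : Module ℂ (PreGNS hφ) :=
  inferInstanceAs (Module ℂ (G →₀ ℂ))

/-- The identity map from finitely supported measures to `PreGNS hφ`. -/
def toPreGNS (hφ : IsPositiveType φ) : (G →₀ ℂ) ≃ₗ[ℂ] PreGNS hφ := LinearEquiv.refl ℂ _

/-- The pre-inner product structure on finitely supported measures. -/
abbrev preGNSCore (hφ : IsPositiveType φ) : PreInnerProductSpace.Core ℂ (PreGNS hφ) where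
  inner μ ν := preInner φ ((toPreGNS hφ).symm μ) ((toPreGNS hφ).symm ν)
  conj_inner_symm _ _ := preInner_conj hφ _ _
  re_inner_nonneg _ := (Complex.le_def.1 (preInner_self_nonneg hφ _)).1
  add_left _ _ _ := preInner_add_left φ _ _ _
  smul_left _ _ _ := preInner_smul_left φ _ _ _

instance (hφ : IsPositiveType φ) : SeminormedAddCommGroup (PreGNS hφ) :=
  InnerProductSpace.Core.toSeminormedAddCommGroup (c := preGNSCore hφ)
instance (hφ : IsPositiveType φ) : InnerProductSpace ℂ (PreGNS hφ) :=
  InnerProductSpace.ofCore (preGNSCore hφ)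

/-- The Hilbert space of the GNS construction: the Hausdorff completion of the space of finitely
supported measures. -/
abbrev GNS (hφ : IsPositiveType φ) : Type _ := UniformSpace.Completion (PreGNS hφ)

/-- The class of a finitely supported measure in the GNS Hilbert space. -/
def toGNS (hφ : IsPositiveType φ) (μ : G →₀ ℂ) : GNS hφ := (toPreGNS hφ μ : PreGNS hφ)

theorem inner_toGNS (hφ : IsPositiveType φ) (μ ν : G →₀ ℂ) :
    ⟪toGNS hφ μ, toGNS hφ ν⟫_ℂ = preInner φ μ ν :=
  UniformSpace.Completion.inner_coe _ _

theorem denseRange_toGNS (hφ : IsPositiveType φ) : DenseRange (toGNS hφ) :=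
  UniformSpace.Completion.denseRange_coe.comp (toPreGNS hφ).surjective.denseRange
    (UniformSpace.Completion.continuous_coe _)

/-- The cyclic vector: the class of the point mass at the unit. -/
def gnsVector (hφ : IsPositiveType φ) : GNS hφ := toGNS hφ (Finsupp.single 1 1)

/-- Left translation, as a linear isometry for the seminorm defined by `φ`. -/
def translateIsometry (hφ : IsPositiveType φ) (g : G) : PreGNS hφ →ₗᵢ[ℂ] PreGNS hφ :=
  ((toPreGNS hφ).toLinearMap ∘ₗ translate g ∘ₗ (toPreGNS hφ).symm.toLinearMap).isometryOfInner
    fun _ _ => preInner_translate φ g _ _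

/-- The operator on the GNS Hilbert space which extends left translation by `g`. -/
def gnsOp (hφ : IsPositiveType φ) (g : G) : GNS hφ →L[ℂ] GNS hφ :=
  (translateIsometry hφ g).toContinuousLinearMap.completion

theorem gnsOp_toGNS (hφ : IsPositiveType φ) (g : G) (μ : G →₀ ℂ) :
    gnsOp hφ g (toGNS hφ μ) = toGNS hφ (translate g μ) :=
  ContinuousLinearMap.completion_apply_coe _ _

theorem gnsOp_mul (hφ : IsPositiveType φ) (g h : G) :
    gnsOp hφ (g * h) = gnsOp hφ g * gnsOp hφ h := by
  refine ContinuousLinearMap.coeFn_injective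
    ((denseRange_toGNS hφ).equalizer (gnsOp hφ (g * h)).continuous
      (gnsOp hφ g * gnsOp hφ h).continuous (funext fun μ => ?_))
  change gnsOp hφ (g * h) (toGNS hφ μ) = gnsOp hφ g (gnsOp hφ h (toGNS hφ μ))
  simp only [gnsOp_toGNS, translate_mul]

theorem gnsOp_one (hφ : IsPositiveType φ) : gnsOp hφ 1 = 1 := by
  refine ContinuousLinearMap.coeFn_injective
    ((denseRange_toGNS hφ).equalizer (gnsOp hφ 1).continuous continuous_id (funext fun μ => ?_))
  change gnsOp hφ 1 (toGNS hφ μ) = toGNS hφ μ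
  rw [gnsOp_toGNS, translate_one]

theorem inner_gnsOp (hφ : IsPositiveType φ) (g : G) (v w : GNS hφ) :
    ⟪gnsOp hφ g v, gnsOp hφ g w⟫_ℂ = ⟪v, w⟫_ℂ := by
  induction v, w using UniformSpace.Completion.induction_on₂ with
  | hp => apply isClosed_eq <;> fun_prop
  | ih μ ν =>
    change ⟪gnsOp hφ g (toGNS hφ ((toPreGNS hφ).symm μ)),
      gnsOp hφ g (toGNS hφ ((toPreGNS hφ).symm ν))⟫_ℂ =
      ⟪toGNS hφ ((toPreGNS hφ).symm μ), toGNS hφ ((toPreGNS hφ).symm ν)⟫_ℂ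
    simp only [gnsOp_toGNS, inner_toGNS, preInner_translate]

theorem star_gnsOp (hφ : IsPositiveType φ) (g : G) : star (gnsOp hφ g) = gnsOp hφ g⁻¹ := by
  rw [ContinuousLinearMap.star_eq_adjoint, eq_comm, ContinuousLinearMap.eq_adjoint_iff]
  intro v w
  have h : gnsOp hφ g (gnsOp hφ g⁻¹ v) = v := by
    change (gnsOp hφ g * gnsOp hφ g⁻¹) v = v
    rw [← gnsOp_mul, mul_inv_cancel, gnsOp_one]
    rfl
  rw [← inner_gnsOp hφ g, h]

/-- The unitary representation of `G` on the GNS Hilbert space of `φ`. -/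
def gnsRep (hφ : IsPositiveType φ) : G →* unitary (GNS hφ →L[ℂ] GNS hφ) where
  toFun g := ⟨gnsOp hφ g, by
    rw [Unitary.mem_iff, star_gnsOp, ← gnsOp_mul, ← gnsOp_mul, inv_mul_cancel, mul_inv_cancel,
      gnsOp_one]
    exact ⟨rfl, rfl⟩⟩
  map_one' := Subtype.ext (gnsOp_one hφ)
  map_mul' g h := Subtype.ext (gnsOp_mul hφ g h)

/-- `φ` is the matrix coefficient of the representation at the GNS vector. -/
theorem inner_gnsRep (hφ : IsPositiveType φ) (g : G) :
    ⟪gnsVector hφ, (gnsRep hφ g : GNS hφ →L[ℂ] GNS hφ) (gnsVector hφ)⟫_ℂ = φ g := by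
  change ⟪toGNS hφ (Finsupp.single 1 1), gnsOp hφ g (toGNS hφ (Finsupp.single 1 1))⟫_ℂ = φ g
  rw [gnsOp_toGNS, inner_toGNS]
  simp [preInner, translate, Finsupp.mapDomain_single]

/-- The GNS vector is cyclic: the linear span of its orbit is dense. -/
theorem gnsVector_cyclic (hφ : IsPositiveType φ) :
    Dense (Submodule.span ℂ (Set.range fun g : G =>
      (gnsRep hφ g : GNS hφ →L[ℂ] GNS hφ) (gnsVector hφ)) : Set (GNS hφ)) := by
  refine (denseRange_toGNS hφ).mono ?_
  rintro _ ⟨μ, rfl⟩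
  induction μ using Finsupp.induction_linear with
  | zero => exact Submodule.zero_mem _
  | add μ ν h h' =>
    have e : toGNS hφ (μ + ν) = toGNS hφ μ + toGNS hφ ν := UniformSpace.Completion.coe_add _ _
    rw [e]
    exact Submodule.add_mem _ h h'
  | single g a =>
    have e : toGNS hφ (Finsupp.single g a) = a • gnsOp hφ g (gnsVector hφ) := by
      have e' : Finsupp.single g a = a • translate g (Finsupp.single (1 : G) (1 : ℂ)) := by
        simp [translate, Finsupp.mapDomain_single]
      rw [gnsVector, gnsOp_toGNS, e']
      exact UniformSpace.Completion.coe_smul a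
        (toPreGNS hφ (translate g (Finsupp.single (1 : G) (1 : ℂ))))
    rw [e]
    exact Submodule.smul_mem _ _ (Submodule.subset_span ⟨g, rfl⟩)

/-- The commutant `π^φ(G)'`: the algebra of bounded operators on the GNS Hilbert space of `φ` which
commute with `π^φ(g)` for every `g ∈ G`. -/
def gnsCommutant (hφ : IsPositiveType φ) : Subalgebra ℂ (GNS hφ →L[ℂ] GNS hφ) :=
  Subalgebra.centralizer ℂ (Set.range fun g : G => (gnsRep hφ g : GNS hφ →L[ℂ] GNS hφ))

end GNS

end PositiveType

end

/-! For `φ` in the cone, `T ↦ ⟪ξ, T π(g) ξ⟫` identifies the operators `0 ≤ T ≤ 1` of the commutant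
with the elements of the cone dominated by `φ`, and it preserves order both ways
(`exists_gnsCoeff_eq`, `coneLE_gnsCoeff_iff`). The theorem thus becomes a statement about order
intervals of operator algebras.

If the commutants are commutative, represent `x` and `y` by operators `A`, `B` on the GNS space of
`x + y`. Then `A - (A - B)⁺` represents their infimum, because `(A - B)⁺` lies below every operator
of the commutant that dominates `0` and `A - B`. Infima alone make the cone a lattice.

Conversely, a lattice cone has the Riesz decomposition property. For a projection `p` and `0 ≤ a ≤
1` in the commutant, `a ≤ p + (1 - p)` splits `a` as `B + C` with `0 ≤ B ≤ p` and `0 ≤ C ≤ 1 - p`.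
Both parts commute with `p`, so `a` does. Dyadic expansion into projections then makes the whole
commutant commutative. -/

namespace PositiveType

/-! ### Lattice cones and Riesz decomposition -/

section Cone

variable {E : Type*} [AddCommGroup E] [Module ℝ E] {Γ : ConvexCone ℝ E}

theorem ConeLE.trans {x y z : E} (h : ConeLE Γ x y) (h' : ConeLE Γ y z) : ConeLE Γ x z := by
  have := Γ.add_mem h h'
  rwa [add_comm, sub_add_sub_cancel] at this

theorem coneLE_add_right_iff {x y z : E} : ConeLE Γ (x + z) (y + z) ↔ ConeLE Γ x y := by
  simp only [ConeLE, add_sub_add_right_eq_sub]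

theorem coneLE_add_right (x : E) {z : E} (hz : z ∈ Γ) : ConeLE Γ x (x + z) := by
  simpa only [ConeLE, add_sub_cancel_left] using hz

/-- If all greatest lower bounds exist, they are translation invariant. -/
theorem IsConeInf.coneLE_add
    (H : ∀ x ∈ Γ, ∀ y ∈ Γ, ∃ i, IsConeInf Γ x y i) {x y z i t : E} (hx : x ∈ Γ) (hy : y ∈ Γ)
    (hz : z ∈ Γ) (hi : IsConeInf Γ x y i) (ht : t ∈ Γ) (htx : ConeLE Γ t (x + z))
    (hty : ConeLE Γ t (y + z)) : ConeLE Γ t (i + z) := by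
  obtain ⟨j, hj, hjx, hjy, hjm⟩ := H (x + z) (Γ.add_mem hx hz) (y + z) (Γ.add_mem hy hz)
  -- Greatest lower bounds are tested only against elements of `Γ`; this puts `j - z` in `Γ`, so
  -- that it can be compared with `i`.
  have hzj : ConeLE Γ z j := by
    refine hjm z hz ?_ ?_
    · rw [add_comm]; exact coneLE_add_right z hx
    · rw [add_comm]; exact coneLE_add_right z hy
  refine (hjm t ht htx hty).trans ?_
  have e : j = (j - z) + z := (sub_add_cancel j z).symm
  rw [e] at hjx hjy ⊢
  rw [coneLE_add_right_iff] at hjx hjy ⊢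
  exact hi.2.2.2 _ hzj hjx hjy

/-- A cone in which all greatest lower bounds exist is a lattice. -/
theorem isLatticeCone_of_isConeInf
    (H : ∀ x ∈ Γ, ∀ y ∈ Γ, ∃ i, IsConeInf Γ x y i) : IsLatticeCone Γ := by
  intro x hx y hy
  obtain ⟨i, hi⟩ := H x hx y hy
  refine ⟨⟨x + y - i, ?_, ?_, ?_, ?_⟩, i, hi⟩
  · have := Γ.add_mem hx hi.2.2.1
    rwa [← add_sub_assoc] at this
  · have := hi.2.2.1
    simp only [ConeLE] at this ⊢
    convert this using 1
    abel
  · have := hi.2.1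
    simp only [ConeLE] at this ⊢
    convert this using 1
    abel
  · intro t ht hxt hyt
    -- If `t` dominates `x` and `y`, then `x + y` is below both `x + t` and `y + t`, hence below `i
    -- + t`.
    have := hi.coneLE_add H hx hy ht (Γ.add_mem hx hy)
      (by simp only [ConeLE] at hyt ⊢; convert hyt using 1; abel)
      (by simp only [ConeLE] at hxt ⊢; convert hxt using 1; abel)
    simp only [ConeLE] at this ⊢
    convert this using 1
    abel

/-- The Riesz decomposition property of a lattice cone. -/
theorem IsLatticeCone.exists_add_eq (H : IsLatticeCone Γ) {a x y : E}
    (ha : a ∈ Γ) (hx : x ∈ Γ) (hy : y ∈ Γ) (h : ConeLE Γ a (x + y)) :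
    ∃ b ∈ Γ, ∃ c ∈ Γ, ConeLE Γ b x ∧ ConeLE Γ c y ∧ b + c = a := by
  obtain ⟨i, hi⟩ := (H a ha x hx).2
  refine ⟨i, hi.1, a - i, hi.2.1, hi.2.2.1, ?_, add_sub_cancel _ _⟩
  -- `a` is below `a + y` and `x + y`, hence below `i + y`.
  have := hi.coneLE_add (fun x hx y hy => (H x hx y hy).2) ha hx hy ha
    (coneLE_add_right a hy) h
  simp only [ConeLE] at this ⊢
  convert this using 1
  abel

end Cone

end PositiveType

namespace PositiveType

/-! ### Positive parts, and commutation tested on projections -/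

section Operators

open ContinuousLinearMap

/-- Since `(2e - d)² - d² = 4e(e - d)` is positive, a product of commuting positive elements,
monotonicity of the square root gives `|d| ≤ 2e - d`; and `2d⁺ = |d| + d`. -/
theorem posPart_le_of_commute {A : Type*} [CStarAlgebra A] [PartialOrder A] [StarOrderedRing A]
    {d e : A} (hd : IsSelfAdjoint d) (he : 0 ≤ e) (hde : d ≤ e) (hc : Commute d e) :
    d⁺ ≤ e := by
  have h1 : 0 ≤ e * (e - d) :=
    Commute.mul_nonneg he (sub_nonneg.2 hde) ((Commute.refl e).sub_right hc.symm)
  have h2 : 0 ≤ 2 • e - d := by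
    rw [two_nsmul, add_sub_assoc]
    exact add_nonneg he (sub_nonneg.2 hde)
  have h3 : star d * d ≤ star (2 • e - d) * (2 • e - d) := by
    rw [(IsSelfAdjoint.of_nonneg h2).star_eq, hd.star_eq, ← sub_nonneg]
    have : (2 • e - d) * (2 • e - d) - d * d = 4 • (e * (e - d)) := by
      have := hc.eq
      simp only [mul_sub, sub_mul, smul_mul_assoc, mul_smul_comm, this]
      abel
    rw [this]
    exact nsmul_nonneg h1 4
  have h4 : CFC.abs d ≤ 2 • e - d :=
    (CFC.sqrt_le_sqrt _ _ h3).trans_eq (CFC.abs_of_nonneg _ h2)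
  have h5 : 2 • d⁺ ≤ 2 • e := by
    rw [← CFC.abs_add_self d hd]
    exact le_sub_iff_add_le.1 h4
  have h6 := smul_le_smul_of_nonneg_left h5 (by norm_num : (0 : ℝ) ≤ 2⁻¹)
  have h7 : ∀ x : A, (2⁻¹ : ℝ) • (2 • x) = x := fun x => by
    rw [← Nat.cast_smul_eq_nsmul ℝ 2 x, smul_smul, Nat.cast_ofNat,
      inv_mul_cancel₀ (two_ne_zero' ℝ), one_smul]
  rwa [h7, h7] at h6

variable {H : Type*} [NormedAddCommGroup H] [InnerProductSpace ℂ H] [CompleteSpace H]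

theorem mul_starProjection_ker {X u : H →L[ℂ] H} (h : Commute u X) :
    (LinearMap.ker X.toLinearMap).starProjection * u * (LinearMap.ker X.toLinearMap).starProjection =
      u * (LinearMap.ker X.toLinearMap).starProjection := by
  ext v
  refine Submodule.starProjection_eq_self_iff.2 ?_
  have hv : X ((LinearMap.ker X.toLinearMap).starProjection v) = 0 :=
    Submodule.starProjection_apply_mem (LinearMap.ker X.toLinearMap) v
  change X (u ((LinearMap.ker X.toLinearMap).starProjection v)) = 0
  change (X * u) ((LinearMap.ker X.toLinearMap).starProjection v) = 0
  rw [← h.eq]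
  exact (congrArg u hv).trans (map_zero u)

/-- The kernel of `X` is invariant under both `u` and `star u`, so it reduces `u`. -/
theorem commute_starProjection_ker {X u : H →L[ℂ] H} (h : Commute u X) (h' : Commute (star u) X) :
    Commute u (LinearMap.ker X.toLinearMap).starProjection := by
  set q := (LinearMap.ker X.toLinearMap).starProjection with hq
  have hs : star q = q := isSelfAdjoint_starProjection _
  have h1 : q * u * q = u * q := mul_starProjection_ker h
  have h2 : q * star u * q = star u * q := mul_starProjection_ker h'
  have h3 := congrArg star h2
  simp only [star_mul, star_star, hs, ← mul_assoc] at h3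
  exact h1.symm.trans h3

set_option maxHeartbeats 1600000 in
/-- Halving step of the dyadic expansion of `0 ≤ D ≤ 1` in terms of projections. -/
theorem exists_isStarProjection_two_smul_sub {s : Set (H →L[ℂ] H)} (hs : ∀ u ∈ s, star u ∈ s)
    {D : H →L[ℂ] H} (hD : D ∈ Subalgebra.centralizer ℂ s) (h0 : 0 ≤ D) (h1 : D ≤ 1) :
    ∃ p ∈ Subalgebra.centralizer ℂ s, IsStarProjection p ∧ 0 ≤ (2 : ℝ) • D - p ∧
      (2 : ℝ) • D - p ≤ 1 := by
  set E : H →L[ℂ] H := (2 : ℝ) • D - 1 with hE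
  have hDsa : IsSelfAdjoint D := .of_nonneg h0
  have hEsa : IsSelfAdjoint E := ((IsSelfAdjoint.all (2 : ℝ)).smul hDsa).sub (.one _)
  have hcomm : ∀ u ∈ s, Commute u E⁺ := fun u hu => by
    have hu' : Commute E u := by
      have : Commute D u := (hD u hu).symm
      exact (this.smul_left (2 : ℝ)).sub_left (Commute.one_left u)
    rw [CFC.posPart_def]
    exact (hu'.cfcₙ_real _).symm
  -- `1 - q` is the spectral projection of `D` for the values above `1/2`: it plays the part of the
  -- first binary digit of `D`.
  set q := (LinearMap.ker E⁺.toLinearMap).starProjection with hq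
  have hqp : IsStarProjection q := isStarProjection_starProjection
  have hq0 : E⁺ * q = 0 := by
    ext v
    exact Submodule.starProjection_apply_mem (LinearMap.ker E⁺.toLinearMap) v
  have hqn : q * E⁻ = E⁻ := by
    ext v
    refine Submodule.starProjection_eq_self_iff.2 ?_
    change (E⁺ * E⁻) v = 0
    rw [CFC.posPart_mul_negPart]
    rfl
  have hqs : star q = q := hqp.isSelfAdjoint
  have hq0' : q * E⁺ = 0 := by
    have := congrArg star hq0
    rwa [star_mul, hqs, (IsSelfAdjoint.of_nonneg (CFC.posPart_nonneg E)).star_eq, star_zero] at this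
  have hqn' : E⁻ * q = E⁻ := by
    have := congrArg star hqn
    rwa [star_mul, hqs, (IsSelfAdjoint.of_nonneg (CFC.negPart_nonneg E)).star_eq] at this
  have hEd : E⁺ - E⁻ = E := CFC.posPart_sub_negPart E
  have hDd : (2 : ℝ) • D = E⁺ - E⁻ + 1 := by rw [hEd, hE]; abel
  have hqq : q * q = q := hqp.isIdempotentElem
  have hqc : ∀ u ∈ s, Commute u q := fun u hu =>
    commute_starProjection_ker (hcomm u hu) (hcomm _ (hs u hu))
  clear_value q
  refine ⟨1 - q, ?_, hqp.one_sub, ?_, ?_⟩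
  · refine sub_mem (one_mem _) ?_
    intro u hu
    exact (hqc u hu).eq
  -- On the range of `q` the remainder is `2D`; on its complement it is `2D - 1 = E⁺`.
  · have e : (2 : ℝ) • D - (1 - q) = E⁺ + (2 : ℝ) • (star q * D * q) := by
      have : (2 : ℝ) • (star q * D * q) = q - E⁻ := by
        rw [hqs, ← smul_mul_assoc, ← mul_smul_comm, hDd]
        simp only [mul_add, mul_sub, add_mul, sub_mul, hq0', hqn, hqn', mul_one, hqq, zero_mul]
        abel
      rw [this, hDd]
      abel
    rw [e]
    have h2 : 0 ≤ star q * D * q := star_left_conjugate_nonneg h0 q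
    exact add_nonneg (CFC.posPart_nonneg E) (smul_nonneg zero_le_two h2)
  · obtain ⟨r, hr⟩ : ∃ r, r = 1 - q := ⟨_, rfl⟩
    have hrs : star r = r := by rw [hr, star_sub, star_one, hqs]
    have hrr : r * r = r := by rw [hr]; exact hqp.one_sub.isIdempotentElem
    have hrp : r * E⁺ = E⁺ := by rw [hr, sub_mul, one_mul, hq0', sub_zero]
    have hpr : E⁺ * r = E⁺ := by rw [hr, mul_sub, mul_one, hq0, sub_zero]
    have hrn : r * E⁻ = 0 := by rw [hr, sub_mul, one_mul, hqn, sub_self]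
    have h2 : 0 ≤ star r * (1 - D) * r := star_left_conjugate_nonneg (sub_nonneg.2 h1) r
    have h3 : (2 : ℝ) • (star r * (1 - D) * r) = r - E⁺ := by
      have h4 : (2 : ℝ) • (1 - D) = 1 - E⁺ + E⁻ := by
        rw [smul_sub, hDd, two_smul]; abel
      rw [hrs, ← smul_mul_assoc, ← mul_smul_comm, h4]
      simp only [mul_add, mul_sub, sub_mul, mul_one, hrr, hrp, hpr, hrn, add_zero]
    have h5 : 0 ≤ (2 : ℝ) • (star r * (1 - D) * r) := smul_nonneg zero_le_two h2
    rw [h3] at h5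
    rw [← hr, hDd, ← sub_nonneg]
    have e : 1 - (E⁺ - E⁻ + 1 - r) = E⁻ + (r - E⁺) := by abel
    rw [e]
    exact add_nonneg (CFC.negPart_nonneg E) h5

/-- Subtracting a projection that commutes with `a` does not change the commutator, so each halving
step doubles `D * a - a * D` while keeping it a commutator with an operator between `0` and `1`.
Such commutators are bounded by `2‖a‖`, so the original one vanishes. -/
theorem commute_of_commute_isStarProjection {s : Set (H →L[ℂ] H)} (hs : ∀ u ∈ s, star u ∈ s)
    {a : H →L[ℂ] H}
    (ha : ∀ p ∈ Subalgebra.centralizer ℂ s, IsStarProjection p → Commute p a)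
    {D : H →L[ℂ] H} (hD : D ∈ Subalgebra.centralizer ℂ s) (h0 : 0 ≤ D) (h1 : D ≤ 1) :
    Commute D a := by
  have key : ∀ n : ℕ, ∀ D ∈ Subalgebra.centralizer ℂ s, 0 ≤ D → D ≤ 1 →
      ‖D * a - a * D‖ ≤ 2 * ‖a‖ * (1 / 2) ^ n := by
    intro n
    induction n with
    | zero =>
      intro D _ h0 h1
      have hn : ‖D‖ ≤ 1 := (CStarAlgebra.norm_le_one_iff_of_nonneg D h0).2 h1
      calc ‖D * a - a * D‖ ≤ ‖D * a‖ + ‖a * D‖ := norm_sub_le _ _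
        _ ≤ ‖D‖ * ‖a‖ + ‖a‖ * ‖D‖ := add_le_add (norm_mul_le _ _) (norm_mul_le _ _)
        _ ≤ 1 * ‖a‖ + ‖a‖ * 1 := by gcongr
        _ = _ := by ring
    | succ n ih =>
      intro D hD h0 h1
      obtain ⟨p, hp, hpp, h0', h1'⟩ := exists_isStarProjection_two_smul_sub hs hD h0 h1
      have hm : (2 : ℝ) • D - p ∈ Subalgebra.centralizer ℂ s := by
        rw [two_smul]
        exact sub_mem (add_mem hD hD) hp
      have e : (2 : ℝ) • (D * a - a * D) = ((2 : ℝ) • D - p) * a - a * ((2 : ℝ) • D - p) := by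
        simp only [sub_mul, mul_sub, smul_sub, smul_mul_assoc, mul_smul_comm, (ha p hp hpp).eq]
        abel
      have h := ih _ hm h0' h1'
      rw [← e, norm_smul, Real.norm_ofNat] at h
      rw [pow_succ]
      linarith
  have hlim : Filter.Tendsto (fun n : ℕ => 2 * ‖a‖ * (1 / 2 : ℝ) ^ n) Filter.atTop
      (nhds (2 * ‖a‖ * 0)) :=
    (tendsto_pow_atTop_nhds_zero_of_lt_one (by norm_num) (by norm_num)).const_mul _
  rw [mul_zero] at hlim
  have := ge_of_tendsto' hlim fun n => key n D hD h0 h1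
  exact sub_eq_zero.1 (norm_le_zero_iff.1 this)

/-- In a self-adjoint subalgebra of operators, what holds for operators between `0` and `1` holds
for all operators, if it is preserved by linear combinations. -/
theorem mem_of_unitInterval_mem {M : Subalgebra ℂ (H →L[ℂ] H)} (hM : ∀ T ∈ M, star T ∈ M)
    (N : Submodule ℂ (H →L[ℂ] H)) (h : ∀ T ∈ M, 0 ≤ T → T ≤ 1 → T ∈ N) {T : H →L[ℂ] H}
    (hT : T ∈ M) : T ∈ N := by
  have hMr : ∀ (r : ℝ) (T : H →L[ℂ] H), T ∈ M → r • T ∈ M := fun r T hT => by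
    rw [← Complex.coe_smul]; exact M.smul_mem hT _
  have hNr : ∀ (r : ℝ) (T : H →L[ℂ] H), T ∈ N → r • T ∈ N := fun r T hT => by
    rw [← Complex.coe_smul]; exact N.smul_mem _ hT
  have h1N : (1 : H →L[ℂ] H) ∈ N := h 1 (one_mem _) zero_le_one le_rfl
  have sa : ∀ T ∈ M, IsSelfAdjoint T → T ∈ N := by
    intro T hT hsa
    -- `-‖T‖ ≤ T ≤ ‖T‖`, so `T + ‖T‖` divided by this constant lies between `0` and `1`; the extra
    -- `1` covers `T = 0`.
    have hr : 0 < 2 * ‖T‖ + 1 := by positivity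
    have a1 : T ≤ ‖T‖ • (1 : H →L[ℂ] H) := by
      have := hsa.le_algebraMap_norm_self
      rwa [Algebra.algebraMap_eq_smul_one] at this
    have a2 : -(‖T‖ • (1 : H →L[ℂ] H)) ≤ T := by
      have := hsa.neg_algebraMap_norm_le_self
      rwa [Algebra.algebraMap_eq_smul_one] at this
    have hm : (2 * ‖T‖ + 1)⁻¹ • (T + ‖T‖ • (1 : H →L[ℂ] H)) ∈ N := by
      refine h _ (hMr _ _ (add_mem hT (hMr _ _ (one_mem _)))) ?_ ?_
      · exact smul_nonneg (inv_nonneg.2 hr.le) (neg_le_iff_add_nonneg.1 a2)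
      · have : T + ‖T‖ • (1 : H →L[ℂ] H) ≤ (2 * ‖T‖ + 1) • (1 : H →L[ℂ] H) := by
          rw [add_smul, one_smul, two_mul, add_smul]
          exact (add_le_add_left a1 _).trans (le_add_of_nonneg_right zero_le_one)
        refine (smul_le_smul_of_nonneg_left this (inv_nonneg.2 hr.le)).trans_eq ?_
        rw [smul_smul, inv_mul_cancel₀ hr.ne', one_smul]
    have := sub_mem (hNr (2 * ‖T‖ + 1) _ hm) (hNr ‖T‖ _ h1N)
    rwa [smul_smul, mul_inv_cancel₀ hr.ne', one_smul, add_sub_cancel_right] at this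
  have hre : (realPart T : H →L[ℂ] H) ∈ N := by
    refine sa _ ?_ (realPart T).2
    rw [realPart_apply_coe]
    exact hMr _ _ (add_mem hT (hM T hT))
  have him : (imaginaryPart T : H →L[ℂ] H) ∈ N := by
    refine sa _ ?_ (imaginaryPart T).2
    rw [imaginaryPart_apply_coe]
    exact M.smul_mem (hMr _ _ (sub_mem hT (hM T hT))) _
  rw [← realPart_add_I_smul_imaginaryPart T]
  exact add_mem hre (N.smul_mem _ him)

theorem star_mem_centralizer {s : Set (H →L[ℂ] H)} (hs : ∀ u ∈ s, star u ∈ s) {T : H →L[ℂ] H}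
    (hT : T ∈ Subalgebra.centralizer ℂ s) : star T ∈ Subalgebra.centralizer ℂ s := by
  intro u hu
  have := congrArg star (hT _ (hs u hu))
  simpa only [star_mul, star_star] using this.symm

/-- The centralizer of a self-adjoint set of operators is commutative as soon as its projections
commute with its elements between `0` and `1`. -/
theorem commute_of_forall_commute_isStarProjection {s : Set (H →L[ℂ] H)}
    (hs : ∀ u ∈ s, star u ∈ s)
    (h : ∀ p ∈ Subalgebra.centralizer ℂ s, IsStarProjection p →
      ∀ a ∈ Subalgebra.centralizer ℂ s, 0 ≤ a → a ≤ 1 → Commute p a)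
    {S T : H →L[ℂ] H} (hS : S ∈ Subalgebra.centralizer ℂ s)
    (hT : T ∈ Subalgebra.centralizer ℂ s) : Commute S T := by
  have hM : ∀ T ∈ Subalgebra.centralizer ℂ s, star T ∈ Subalgebra.centralizer ℂ s :=
    fun _ => star_mem_centralizer hs
  have h1 : ∀ a ∈ Subalgebra.centralizer ℂ s, 0 ≤ a → a ≤ 1 →
      ∀ T ∈ Subalgebra.centralizer ℂ s, Commute a T := by
    intro a ha h0 h1 T hT
    have := mem_of_unitInterval_mem hM (Subalgebra.centralizer ℂ {a}).toSubmodule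
      (fun D hD h0' h1' => ?_) hT
    · exact this a rfl
    · intro x hx
      rw [Set.mem_singleton_iff.1 hx]
      exact (commute_of_commute_isStarProjection hs
        (fun p hp hpp => h p hp hpp a ha h0 h1) hD h0' h1').symm
  have := mem_of_unitInterval_mem hM (Subalgebra.centralizer ℂ {T}).toSubmodule
    (fun D hD h0' h1' => ?_) hS
  · exact (this T rfl).symm
  · intro x hx
    rw [Set.mem_singleton_iff.1 hx]
    exact (h1 D hD h0' h1' T hT).symm

end Operators

end PositiveType

noncomputable section
namespace PositiveType

/-! ### Commutant operators as functions dominated by `φ` -/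

section Coefficient

variable {G : Type*} [Group G] {φ : G → ℂ}

theorem mem_gnsCommutant_iff (hφ : IsPositiveType φ) {T : GNS hφ →L[ℂ] GNS hφ} :
    T ∈ gnsCommutant hφ ↔ ∀ g, Commute (gnsOp hφ g) T := by
  refine ⟨fun h g => h _ ⟨g, rfl⟩, ?_⟩
  rintro h _ ⟨g, rfl⟩
  exact h g

theorem gnsOp_apply_mul (hφ : IsPositiveType φ) (g h : G) (v : GNS hφ) :
    gnsOp hφ (g * h) v = gnsOp hφ g (gnsOp hφ h v) := by
  rw [gnsOp_mul]; rfl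

theorem inner_gnsOp_left (hφ : IsPositiveType φ) (g : G) (v w : GNS hφ) :
    ⟪gnsOp hφ g v, w⟫_ℂ = ⟪v, gnsOp hφ g⁻¹ w⟫_ℂ := by
  rw [← inner_gnsOp hφ g v, ← gnsOp_apply_mul, mul_inv_cancel, gnsOp_one]
  rfl

/-- The matrix coefficient `g ↦ ⟪ξ, T π(g) ξ⟫` of the GNS representation at its cyclic vector. -/
def gnsCoeff (hφ : IsPositiveType φ) (T : GNS hφ →L[ℂ] GNS hφ) (g : G) : ℂ :=
  ⟪gnsVector hφ, T (gnsOp hφ g (gnsVector hφ))⟫_ℂ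

theorem gnsCoeff_one (hφ : IsPositiveType φ) : gnsCoeff hφ 1 = φ :=
  funext (inner_gnsRep hφ)

theorem gnsCoeff_sub (hφ : IsPositiveType φ) (S T : GNS hφ →L[ℂ] GNS hφ) :
    gnsCoeff hφ (S - T) = gnsCoeff hφ S - gnsCoeff hφ T := by
  ext g
  exact inner_sub_right _ _ _

theorem gnsCoeff_add (hφ : IsPositiveType φ) (S T : GNS hφ →L[ℂ] GNS hφ) :
    gnsCoeff hφ (S + T) = gnsCoeff hφ S + gnsCoeff hφ T := by
  ext g
  exact inner_add_right _ _ _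

theorem inner_gnsOp_gnsVector (hφ : IsPositiveType φ) {T : GNS hφ →L[ℂ] GNS hφ}
    (hT : T ∈ gnsCommutant hφ) (g h : G) :
    ⟪gnsOp hφ g (gnsVector hφ), T (gnsOp hφ h (gnsVector hφ))⟫_ℂ = gnsCoeff hφ T (g⁻¹ * h) := by
  have : gnsOp hφ g⁻¹ (T (gnsOp hφ h (gnsVector hφ))) =
      T (gnsOp hφ g⁻¹ (gnsOp hφ h (gnsVector hφ))) :=
    congrArg (fun S : GNS hφ →L[ℂ] GNS hφ => S (gnsOp hφ h (gnsVector hφ)))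
      ((mem_gnsCommutant_iff hφ).1 hT g⁻¹).eq
  rw [inner_gnsOp_left, this, ← gnsOp_apply_mul, gnsCoeff]

theorem toGNS_add (hφ : IsPositiveType φ) (μ ν : G →₀ ℂ) :
    toGNS hφ (μ + ν) = toGNS hφ μ + toGNS hφ ν :=
  UniformSpace.Completion.coe_add _ _

theorem toGNS_smul (hφ : IsPositiveType φ) (a : ℂ) (μ : G →₀ ℂ) :
    toGNS hφ (a • μ) = a • toGNS hφ μ :=
  UniformSpace.Completion.coe_smul a (toPreGNS hφ μ)

theorem toGNS_single (hφ : IsPositiveType φ) (g : G) (a : ℂ) :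
    toGNS hφ (Finsupp.single g a) = a • gnsOp hφ g (gnsVector hφ) := by
  rw [gnsVector, gnsOp_toGNS, ← toGNS_smul]
  simp [translate, Finsupp.mapDomain_single]

theorem toGNS_eq_sum (hφ : IsPositiveType φ) (μ : G →₀ ℂ) :
    toGNS hφ μ = μ.sum fun g a => a • gnsOp hφ g (gnsVector hφ) := by
  induction μ using Finsupp.induction_linear with
  | zero => exact UniformSpace.Completion.coe_zero
  | add μ ν h h' =>
    rw [toGNS_add, h, h', Finsupp.sum_add_index' (by simp) (by simp [add_smul])]
  | single g a => rw [toGNS_single, Finsupp.sum_single_index (by simp)]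

/-- The coefficient of `T` determines its sesquilinear form on a dense subspace. Hence `T` is
determined by its coefficient, and positivity of `T` amounts to positive type. -/
theorem inner_toGNS_apply (hφ : IsPositiveType φ) {T : GNS hφ →L[ℂ] GNS hφ}
    (hT : T ∈ gnsCommutant hφ) (μ ν : G →₀ ℂ) :
    ⟪toGNS hφ μ, T (toGNS hφ ν)⟫_ℂ = preInner (gnsCoeff hφ T) μ ν := by
  simp only [toGNS_eq_sum, Finsupp.sum, map_sum, sum_inner, inner_sum, preInner, map_smul,
    inner_smul_left, inner_smul_right, inner_gnsOp_gnsVector hφ hT, Finset.mul_sum]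
  rw [Finset.sum_comm]
  refine Finset.sum_congr rfl fun x _ => Finset.sum_congr rfl fun y _ => ?_
  ring

theorem gnsCoeff_injective (hφ : IsPositiveType φ) {S T : GNS hφ →L[ℂ] GNS hφ}
    (hS : S ∈ gnsCommutant hφ) (hT : T ∈ gnsCommutant hφ) (h : gnsCoeff hφ S = gnsCoeff hφ T) :
    S = T := by
  refine ContinuousLinearMap.coeFn_injective
    ((denseRange_toGNS hφ).equalizer S.continuous T.continuous (funext fun ν => ?_))
  refine (denseRange_toGNS hφ).eq_of_inner_right ℂ fun μ => ?_
  simp only [Function.comp_apply, inner_toGNS_apply hφ hS, inner_toGNS_apply hφ hT, h]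

theorem isPositiveType_gnsCoeff (hφ : IsPositiveType φ) {T : GNS hφ →L[ℂ] GNS hφ}
    (hT : T ∈ gnsCommutant hφ) (h : 0 ≤ T) : IsPositiveType (gnsCoeff hφ T) := by
  intro n g c
  refine (((ContinuousLinearMap.nonneg_iff_isPositive T).1 h).inner_nonneg_right
    (∑ i, c i • gnsOp hφ (g i) (gnsVector hφ))).trans_eq ?_
  simp only [map_sum, sum_inner, inner_sum, map_smul,
    inner_smul_left, inner_smul_right, inner_gnsOp_gnsVector hφ hT, Finset.mul_sum]
  refine Finset.sum_congr rfl fun x _ => Finset.sum_congr rfl fun y _ => ?_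
  ring

theorem nonneg_of_isPositiveType_gnsCoeff (hφ : IsPositiveType φ) {T : GNS hφ →L[ℂ] GNS hφ}
    (hT : T ∈ gnsCommutant hφ) (h : IsPositiveType (gnsCoeff hφ T)) : 0 ≤ T := by
  rw [ContinuousLinearMap.nonneg_iff_isPositive, ContinuousLinearMap.isPositive_iff]
  have key : ∀ v, 0 ≤ ⟪v, T v⟫_ℂ := by
    intro v
    refine (denseRange_toGNS hφ).induction_on (p := fun v => 0 ≤ ⟪v, T v⟫_ℂ) v ?_ fun μ => ?_
    · exact isClosed_le continuous_const (continuous_id.inner T.continuous)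
    · rw [inner_toGNS_apply hφ hT]
      exact preInner_self_nonneg h μ
  have key' : ∀ v, ⟪T v, v⟫_ℂ = ⟪v, T v⟫_ℂ := fun v => by
    rw [← inner_conj_symm]
    exact Complex.conj_eq_iff_im.2 (Complex.le_def.1 (key v)).2.symm
  refine ⟨(LinearMap.isSymmetric_iff_inner_map_self_real _).2 fun v => ?_, fun v => ?_⟩
  · rw [inner_conj_symm]
    exact (key' v).symm
  · rw [key']
    exact key v

/-- Yields both the continuity of the orbit map and, when `φ` is `K`-biinvariant, the `K`-invariance
of the cyclic vector. -/
theorem norm_sub_sq_gnsOp (hφ : IsPositiveType φ) (g h : G) :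
    ‖gnsOp hφ g (gnsVector hφ) - gnsOp hφ h (gnsVector hφ)‖ ^ 2 =
      2 * (φ 1).re - 2 * (φ (g⁻¹ * h)).re := by
  have e : ∀ g h, ⟪gnsOp hφ g (gnsVector hφ), gnsOp hφ h (gnsVector hφ)⟫_ℂ = φ (g⁻¹ * h) :=
    fun g h => by
      have := inner_gnsOp_gnsVector hφ (one_mem (gnsCommutant hφ)) g h
      rwa [gnsCoeff_one] at this
  have n : ∀ g, ‖gnsOp hφ g (gnsVector hφ)‖ ^ 2 = (φ 1).re := fun g => by
    rw [← inner_self_eq_norm_sq (𝕜 := ℂ), e, inv_mul_cancel]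
    rfl
  rw [norm_sub_sq (𝕜 := ℂ), n, n, e]
  change _ - 2 * (φ (g⁻¹ * h)).re + _ = _
  ring

theorem continuous_gnsOp_gnsVector [TopologicalSpace G] [IsTopologicalGroup G]
    (hφ : IsPositiveType φ) (hc : Continuous φ) :
    Continuous fun g => gnsOp hφ g (gnsVector hφ) := by
  refine continuous_iff_continuousAt.2 fun h => ?_
  rw [ContinuousAt, tendsto_iff_norm_sub_tendsto_zero]
  have h1 : Filter.Tendsto (fun g => √(2 * (φ 1).re - 2 * (φ (g⁻¹ * h)).re)) (nhds h)
      (nhds √(2 * (φ 1).re - 2 * (φ (h⁻¹ * h)).re)) := by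
    refine Continuous.tendsto (f := fun g => √(2 * (φ 1).re - 2 * (φ (g⁻¹ * h)).re)) ?_ h
    exact (continuous_const.sub (continuous_const.mul (Complex.continuous_re.comp
      (hc.comp (continuous_inv.mul continuous_const))))).sqrt
  rw [inv_mul_cancel, sub_self, Real.sqrt_zero] at h1
  refine h1.congr fun g => ?_
  rw [← norm_sub_sq_gnsOp hφ, Real.sqrt_sq (norm_nonneg _)]

theorem gnsOp_gnsVector_of_mem (hφ : IsPositiveType φ) {K : Subgroup G}
    (hK : IsBiinvariant K φ) {k : G} (hk : k ∈ K) :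
    gnsOp hφ k (gnsVector hφ) = gnsVector hφ := by
  have h := norm_sub_sq_gnsOp hφ 1 k
  have e : φ (1⁻¹ * k) = φ 1 := by
    simpa using hK 1 K.one_mem k hk 1
  rw [e, sub_self, sq_eq_zero_iff, norm_eq_zero, sub_eq_zero, gnsOp_one] at h
  exact h.symm

theorem gnsCoeff_mem_biinvariantCone [TopologicalSpace G] [IsTopologicalGroup G]
    {K : Subgroup G} (hφ : φ ∈ biinvariantCone K) {T : GNS hφ.1 →L[ℂ] GNS hφ.1}
    (hT : T ∈ gnsCommutant hφ.1) (h : 0 ≤ T) : gnsCoeff hφ.1 T ∈ biinvariantCone K := by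
  refine ⟨isPositiveType_gnsCoeff hφ.1 hT h, ?_, fun k₁ hk₁ k₂ hk₂ g => ?_⟩
  · exact continuous_const.inner
      (T.continuous.comp (continuous_gnsOp_gnsVector hφ.1 hφ.2.1))
  · have h := inner_gnsOp_gnsVector hφ.1 hT k₁⁻¹ g
    rw [gnsOp_gnsVector_of_mem hφ.1 hφ.2.2 (K.inv_mem hk₁), inv_inv] at h
    rw [gnsCoeff, gnsOp_apply_mul, gnsOp_gnsVector_of_mem hφ.1 hφ.2.2 hk₂]
    exact h.symm

/-- A function dominated by `φ` is a coefficient of the GNS representation of `φ`. -/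
theorem exists_gnsCoeff_eq (hφ : IsPositiveType φ) {ψ : G → ℂ} (hψ : IsPositiveType ψ)
    (h : IsPositiveType (φ - ψ)) : ∃ T ∈ gnsCommutant hφ, gnsCoeff hφ T = ψ := by
  -- As `φ - ψ` is of positive type, the identity on finitely supported measures is a contraction
  -- from the `φ`-seminorm to the `ψ`-seminorm. Its extension `V` intertwines the two
  -- representations, and `V* V` is the required operator.
  let L : PreGNS hφ →ₗ[ℂ] PreGNS hψ :=
    (toPreGNS hψ).toLinearMap ∘ₗ (toPreGNS hφ).symm.toLinearMap
  have hL : ∀ μ, ‖L μ‖ ≤ 1 * ‖μ‖ := by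
    intro μ
    rw [one_mul, ← sq_le_sq₀ (norm_nonneg _) (norm_nonneg _),
      ← inner_self_eq_norm_sq (𝕜 := ℂ), ← inner_self_eq_norm_sq (𝕜 := ℂ)]
    have h1 := preInner_self_nonneg h ((toPreGNS hφ).symm μ)
    have h2 : preInner (φ - ψ) ((toPreGNS hφ).symm μ) ((toPreGNS hφ).symm μ) =
        preInner φ ((toPreGNS hφ).symm μ) ((toPreGNS hφ).symm μ) -
          preInner ψ ((toPreGNS hφ).symm μ) ((toPreGNS hφ).symm μ) := by
      simp only [preInner, Finsupp.sum, Pi.sub_apply, mul_sub, Finset.sum_sub_distrib]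
    rw [h2, sub_nonneg] at h1
    exact (Complex.le_def.1 h1).1
  let V : GNS hφ →L[ℂ] GNS hψ := (L.mkContinuous 1 hL).completion
  have hV : ∀ μ, V (toGNS hφ μ) = toGNS hψ μ := fun μ =>
    ContinuousLinearMap.completion_apply_coe _ _
  have hVg : ∀ g v, V (gnsOp hφ g v) = gnsOp hψ g (V v) := by
    intro g v
    refine (denseRange_toGNS hφ).induction_on
      (p := fun v => V (gnsOp hφ g v) = gnsOp hψ g (V v)) v ?_ fun μ => ?_
    · exact isClosed_eq (V.continuous.comp (gnsOp hφ g).continuous)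
        ((gnsOp hψ g).continuous.comp V.continuous)
    · rw [gnsOp_toGNS, hV, hV, gnsOp_toGNS]
  refine ⟨V.adjoint ∘L V, (mem_gnsCommutant_iff hφ).2 fun g => ?_, ?_⟩
  · ext v
    refine ext_inner_left ℂ fun w => ?_
    simp only [mul_apply_eq_comp, ContinuousLinearMap.comp_apply]
    rw [ContinuousLinearMap.adjoint_inner_right, hVg, ← inv_inv g, ← inner_gnsOp_left,
      ← inner_gnsOp_left, ContinuousLinearMap.adjoint_inner_right, hVg]
  · ext g
    rw [gnsCoeff, ContinuousLinearMap.comp_apply, ContinuousLinearMap.adjoint_inner_right, hVg,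
      gnsVector, hV]
    exact inner_gnsRep hψ g

end Coefficient

end PositiveType
end

noncomputable section
namespace PositiveType

/-! ### The two implications -/

variable {G : Type*} [Group G] [TopologicalSpace G] [IsTopologicalGroup G] {K : Subgroup G}
  {φ : G → ℂ}

theorem coneLE_gnsCoeff_iff (hφ : φ ∈ biinvariantCone K) {S T : GNS hφ.1 →L[ℂ] GNS hφ.1}
    (hS : S ∈ gnsCommutant hφ.1) (hT : T ∈ gnsCommutant hφ.1) :
    ConeLE (biinvariantCone K) (gnsCoeff hφ.1 S) (gnsCoeff hφ.1 T) ↔ S ≤ T := by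
  rw [ConeLE, ← gnsCoeff_sub, ← sub_nonneg]
  exact ⟨fun h => nonneg_of_isPositiveType_gnsCoeff hφ.1 (sub_mem hT hS) h.1,
    gnsCoeff_mem_biinvariantCone hφ (sub_mem hT hS)⟩

theorem exists_isConeInf_of_commute (hφ : φ ∈ biinvariantCone K)
    (hcomm : ∀ S ∈ gnsCommutant hφ.1, ∀ T ∈ gnsCommutant hφ.1, S * T = T * S) {x y : G → ℂ}
    (hx : x ∈ biinvariantCone K) (hy : y ∈ biinvariantCone K)
    (hxφ : ConeLE (biinvariantCone K) x φ) (hyφ : ConeLE (biinvariantCone K) y φ) :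
    ∃ i, IsConeInf (biinvariantCone K) x y i := by
  obtain ⟨A, hA, rfl⟩ := exists_gnsCoeff_eq hφ.1 hx.1 hxφ.1
  obtain ⟨B, hB, rfl⟩ := exists_gnsCoeff_eq hφ.1 hy.1 hyφ.1
  have hA0 := nonneg_of_isPositiveType_gnsCoeff hφ.1 hA hx.1
  have hB0 := nonneg_of_isPositiveType_gnsCoeff hφ.1 hB hy.1
  have hD := sub_mem hA hB
  have hDsa : IsSelfAdjoint (A - B) := (IsSelfAdjoint.of_nonneg hA0).sub (.of_nonneg hB0)
  have hDp : (A - B)⁺ ∈ gnsCommutant hφ.1 := by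
    refine (mem_gnsCommutant_iff hφ.1).2 fun g => ?_
    rw [CFC.posPart_def]
    exact (((mem_gnsCommutant_iff hφ.1).1 hD g).symm.cfcₙ_real _).symm
  have hle : ∀ E ∈ gnsCommutant hφ.1, 0 ≤ E → A - B ≤ E → (A - B)⁺ ≤ E := fun E hE h0 h1 =>
    posPart_le_of_commute hDsa h0 h1 (hcomm _ hD E hE)
  have hC := sub_mem hA hDp
  refine ⟨gnsCoeff hφ.1 (A - (A - B)⁺), ?_, ?_, ?_, fun t ht htA htB => ?_⟩
  · exact gnsCoeff_mem_biinvariantCone hφ hC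
      (sub_nonneg.2 (hle A hA hA0 (sub_le_self A hB0)))
  · exact (coneLE_gnsCoeff_iff hφ hC hA).2 (sub_le_self A (CFC.posPart_nonneg _))
  · exact (coneLE_gnsCoeff_iff hφ hC hB).2 (sub_le_comm.1 (CFC.le_posPart hDsa))
  -- `A - T` dominates both `0` and `A - B`, hence `(A - B)⁺`.
  · obtain ⟨T, hT, rfl⟩ := exists_gnsCoeff_eq hφ.1 ht.1 (htA.trans hxφ).1
    rw [coneLE_gnsCoeff_iff hφ hT hA] at htA
    rw [coneLE_gnsCoeff_iff hφ hT hB] at htB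
    rw [coneLE_gnsCoeff_iff hφ hT hC]
    exact le_sub_comm.1 (hle _ (sub_mem hA hT) (sub_nonneg.2 htA) (sub_le_sub_left htB A))

/-- Compressing `0 ≤ a ≤ p` by `1 - p` gives `0`; writing `a = b* b`, this says `b (1 - p) = 0`. -/
theorem eq_mul_of_nonneg_of_le_isStarProjection {H : Type*} [NormedAddCommGroup H]
    [InnerProductSpace ℂ H] [CompleteSpace H] {a p : H →L[ℂ] H} (hp : IsStarProjection p)
    (h0 : 0 ≤ a) (h : a ≤ p) : a * p = a := by
  have h1 : a * (1 - p) = 0 := by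
    have h2 : star (1 - p) * a * (1 - p) ≤ star (1 - p) * p * (1 - p) :=
      star_left_conjugate_le_conjugate h (1 - p)
    rw [mul_assoc _ p, hp.isIdempotentElem.mul_one_sub_self, mul_zero] at h2
    have h3 : star (1 - p) * a * (1 - p) = 0 := h2.antisymm (star_left_conjugate_nonneg h0 _)
    obtain ⟨b, rfl⟩ := CStarAlgebra.nonneg_iff_eq_star_mul_self.1 h0
    have h4 : star (b * (1 - p)) * (b * (1 - p)) = 0 := by
      rw [star_mul, ← h3]
      simp only [mul_assoc]
    rw [mul_assoc, CStarRing.star_mul_self_eq_zero_iff _ |>.1 h4, mul_zero]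
  rw [mul_sub, mul_one, sub_eq_zero] at h1
  exact h1.symm

theorem commute_of_nonneg_of_le_isStarProjection {H : Type*} [NormedAddCommGroup H]
    [InnerProductSpace ℂ H] [CompleteSpace H] {a p : H →L[ℂ] H} (hp : IsStarProjection p)
    (h0 : 0 ≤ a) (h : a ≤ p) : Commute p a := by
  have h1 := eq_mul_of_nonneg_of_le_isStarProjection hp h0 h
  have h2 := congrArg star h1
  rw [star_mul, hp.isSelfAdjoint.star_eq, (IsSelfAdjoint.of_nonneg h0).star_eq] at h2
  exact h2.trans h1.symm

theorem commute_of_isLatticeCone (hl : IsLatticeCone (biinvariantCone K))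
    (hφ : φ ∈ biinvariantCone K) {S T : GNS hφ.1 →L[ℂ] GNS hφ.1}
    (hS : S ∈ gnsCommutant hφ.1) (hT : T ∈ gnsCommutant hφ.1) : Commute S T := by
  refine commute_of_forall_commute_isStarProjection ?_ ?_ hS hT
  · rintro _ ⟨g, rfl⟩
    exact ⟨g⁻¹, (star_gnsOp hφ.1 g).symm⟩
  intro p hp hpp a ha h0 h1
  change p ∈ gnsCommutant hφ.1 at hp
  change a ∈ gnsCommutant hφ.1 at ha
  have hq : 1 - p ∈ gnsCommutant hφ.1 := sub_mem (one_mem _) hp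
  have hle : ConeLE (biinvariantCone K) (gnsCoeff hφ.1 a)
      (gnsCoeff hφ.1 p + gnsCoeff hφ.1 (1 - p)) := by
    rw [← gnsCoeff_add, add_sub_cancel, coneLE_gnsCoeff_iff hφ ha (one_mem _)]
    exact h1
  have below : ∀ r ∈ gnsCommutant hφ.1, r ≤ 1 → ∀ b ∈ biinvariantCone K,
      ConeLE (biinvariantCone K) b (gnsCoeff hφ.1 r) →
      ∃ R ∈ gnsCommutant hφ.1, 0 ≤ R ∧ R ≤ r ∧ gnsCoeff hφ.1 R = b := by
    intro r hr hr1 b hb hbr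
    have hrφ := (coneLE_gnsCoeff_iff hφ hr (one_mem _)).2 hr1
    rw [gnsCoeff_one] at hrφ
    obtain ⟨R, hR, rfl⟩ := exists_gnsCoeff_eq hφ.1 hb.1 (hbr.trans hrφ).1
    exact ⟨R, hR, nonneg_of_isPositiveType_gnsCoeff hφ.1 hR hb.1,
      (coneLE_gnsCoeff_iff hφ hR hr).1 hbr, rfl⟩
  -- Riesz decomposition gives functions; `below` turns them back into operators, whose sum is `a`
  -- because coefficients determine operators.
  obtain ⟨b, hb, c, hc, hbp, hcq, hbc⟩ := hl.exists_add_eq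
    (gnsCoeff_mem_biinvariantCone hφ ha h0) (gnsCoeff_mem_biinvariantCone hφ hp hpp.nonneg)
    (gnsCoeff_mem_biinvariantCone hφ hq hpp.one_sub.nonneg) hle
  obtain ⟨B, hB, hB0, hBp, rfl⟩ := below p hp (sub_nonneg.1 hpp.one_sub.nonneg) b hb hbp
  obtain ⟨C, hC, hC0, hCq, rfl⟩ := below (1 - p) hq (sub_le_self 1 hpp.nonneg) c hc hcq
  rw [← gnsCoeff_add] at hbc
  rw [← gnsCoeff_injective hφ.1 (add_mem hB hC) ha hbc]
  refine (commute_of_nonneg_of_le_isStarProjection hpp hB0 hBp).add_right ?_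
  have := commute_of_nonneg_of_le_isStarProjection hpp.one_sub hC0 hCq
  simpa only [sub_sub_cancel] using (Commute.one_left C).sub_left this

end PositiveType
end

theorem theorem2 {G : Type*} [Group G] [TopologicalSpace G] [IsTopologicalGroup G] [T2Space G]
    (K : Subgroup G) (hK : IsClosed (K : Set G)) :
    PositiveType.IsLatticeCone (PositiveType.biinvariantCone K) ↔
      ∀ (φ : G → ℂ) (hφ : φ ∈ PositiveType.biinvariantCone K),
        ∀ S ∈ PositiveType.gnsCommutant hφ.1, ∀ T ∈ PositiveType.gnsCommutant hφ.1,
          S * T = T * S := by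
  refine ⟨fun h φ hφ S hS T hT => PositiveType.commute_of_isLatticeCone h hφ hS hT, fun h => ?_⟩
  refine PositiveType.isLatticeCone_of_isConeInf fun x hx y hy => ?_
  -- `x + y` dominates `x`, `y` and all their lower bounds, so a single GNS space represents them
  -- all.
  have hφ := (PositiveType.biinvariantCone K).add_mem hx hy
  refine PositiveType.exists_isConeInf_of_commute hφ (h _ hφ) hx hy
    (PositiveType.coneLE_add_right x hy) ?_
  rw [add_comm]
  exact PositiveType.coneLE_add_right y hx
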